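/- Let $K$ be a number field with ring of integers $\mathcal{O}_K$, let $f \in \mathcal{O}_K[X]$ be a square-free monic polynomial of odd degree at least $3$, and let $S$ be a finite set of nonzero prime ideals of $\mathcal{O}_K$. Let $$\mathcal{O}_{K,S} = \{x \in K : \nu_{\mathfrak{p}}(x) \ge 0 \text{ for every nonzero prime ideal } \mathfrak{p} \notin S\}$$ be the ring of $S$-integers of $K$, and put $$A_S = \mathcal{O}_{K,S}[X,Y]/\langle Y^2-f(X)\rangle, \qquad A_K = K[X,Y]/\langle Y^2-f(X)\rangle .$$ Restriction to the generic fibre, that is, $[M] \mapsto [A_K \otimes_{A_S} M]$ for invertible $A_S$-modules $M$ (where $A_S \to A_K$ is induced by the inclusion $\mathcal{O}_{K,S} \subset K$), gives a homomorphism of abelian groups $$\theta \colon \mathrm{Pic}(A_S) \longrightarrow \mathrm{Pic}(A_K).$$ Moreover: (1) if $S$ contains all the prime ideals of $\mathcal{O}_K$ dividing $2\,\mathrm{disc}(f)$, then $\theta$ is surjective; (2) if $\mathcal{O}_{K,S}$ is a principal ideal domain, then $\theta$ is injective. -/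

import Mathlib

open Polynomial
open scoped NumberField TensorProduct

universe u

/-- The affine coordinate ring `T[X, Y] / (Y² - f(X))` of the curve `Y² = f(X)` over an
`R`-algebra `T`, where `f ∈ R[X]`. The outer variable of `T[X][Y]` plays the role of `Y`. -/
noncomputable abbrev CurveRing {R : Type*} [CommRing R] (f : R[X]) (T : Type*) [CommRing T]
    [Algebra R T] : Type _ :=
  AdjoinRoot ((X : T[X][X]) ^ 2 - C (f.map (algebraMap R T)))

/-- The ring homomorphism `T[X, Y] / (Y² - f(X)) → T'[X, Y] / (Y² - f(X))` that a homomorphism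
`φ : T → T'` of `R`-algebras induces: it is `φ` on `T` and sends `X` to `X` and `Y` to `Y`. -/
noncomputable def CurveRing.map {R : Type*} [CommRing R] (f : R[X]) {T T' : Type*} [CommRing T]
    [CommRing T'] [Algebra R T] [Algebra R T'] (φ : T →ₐ[R] T') :
    CurveRing f T →+* CurveRing f T' :=
  AdjoinRoot.map (Polynomial.mapRingHom (φ : T →+* T')) _ _ (by
    have h : (φ : T →+* T').comp (algebraMap R T) = algebraMap R T' := φ.comp_algebraMap
    simp [Polynomial.map_map, h])

/-- The homomorphism `O_{K,S}[X, Y] / (Y² - f(X)) → K[X, Y] / (Y² - f(X))` that the inclusion of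
the ring of `S`-integers `O_{K,S}` in `K` induces. On spectra it is the inclusion of the generic
fibre. -/
noncomputable def genericFibreHom {K : Type*} [Field K] [NumberField K] (f : (𝓞 K)[X])
    (S : Set (IsDedekindDomain.HeightOneSpectrum (𝓞 K))) :
    CurveRing f (S.integer K) →+* CurveRing f K :=
  CurveRing.map f (S.integer K).val

/-! Write R for the ring of S-integers, A for the curve ring over R and B for the one over K. Then B
is A with the nonzero elements of R inverted.

Injectivity: a class that dies in Pic B is represented by an ideal I of A with I * J = (n) for some
nonzero n in R. Since f is monic of odd degree, comparing degrees shows that the curve ring over any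
domain is a domain. Hence primes of the principal ideal domain R stay prime in A and can be
cancelled from I * J one at a time, until I is seen to be principal
(`Ideal.isPrincipal_of_mul_eq_span_algebraMap`).

Surjectivity: a class of Pic B is an ideal I dividing a nonzero principal ideal, and its contraction
I' to A turns out to be locally principal. At a maximal ideal over 0 this is inherited from I. Over
p ≠ 0 the fibre A/pA is Dedekind, because 2 disc(f) is a unit modulo p, so the image of I' in it is
locally principal. As I' is saturated with respect to a local generator ϖ of p, its elements
divisible by ϖ lie in ϖI', and Nakayama lifts the generator
(`Ideal.isPrincipalNear_comap_of_fibre`). -/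

open scoped nonZeroDivisors

/-! ### Ideals dividing a principal ideal -/

open scoped Pointwise in
/-- An invertible submodule of a localization is isomorphic to an ideal that divides the principal
ideal generated by some denominator. -/
theorem Submodule.exists_ideal_mul_eq_span {A B : Type*} [CommRing A] [CommRing B] [Algebra A B]
    [FaithfulSMul A B] (M : Submonoid A) [IsLocalization M B] (U : (Submodule A B)ˣ) :
    ∃ (I J : Ideal A) (d : A), d ∈ M ∧ I * J = Ideal.span {d} ∧ Nonempty (U.1 ≃ₗ[A] I) := by
  let V : FractionalIdeal M B := ⟨U.1, U.submodule_isFractional (S := M)⟩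
  let W : FractionalIdeal M B := ⟨(U⁻¹).1, (U⁻¹).submodule_isFractional (S := M)⟩
  refine ⟨V.num, W.num, V.den * W.den, mul_mem V.den.2 W.den.2, ?_,
    ⟨FractionalIdeal.equivNumOfIsLocalization V⟩⟩
  have hinj : Function.Injective (Algebra.linearMap A B) := FaithfulSMul.algebraMap_injective A B
  apply Submodule.map_injective_of_injective hinj
  have h : Submodule.map (Algebra.linearMap A B) (V.num * W.num) =
      Submodule.map (Algebra.linearMap A B) V.num * Submodule.map (Algebra.linearMap A B) W.num :=
    Submodule.map_mul V.num W.num (Algebra.ofId A B)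
  rw [h, ← FractionalIdeal.den_mul_self_eq_num, ← FractionalIdeal.den_mul_self_eq_num]
  have h1 : (V : Submodule A B) * (W : Submodule A B) = 1 := U.mul_inv
  rw [Submonoid.smul_def, Submonoid.smul_def, smul_mul_smul_comm, h1, Submodule.one_eq_span,
    Ideal.span, LinearMap.map_span, Set.image_singleton, Submodule.smul_span]
  simp [Algebra.smul_def, Set.smul_set_singleton]

/-- If prime elements of `R` stay prime in `A`, then an ideal of `A` dividing a nonzero element
of `R` is principal. -/
theorem Ideal.isPrincipal_of_mul_eq_span_algebraMap {R A : Type*} [CommRing R] [IsDomain R]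
    [UniqueFactorizationMonoid R] [CommRing A] [IsDomain A] [Algebra R A]
    (hprime : ∀ p : R, Prime p → Prime (algebraMap R A p)) (n : R) :
    n ≠ 0 → ∀ I J : Ideal A, I * J = Ideal.span {algebraMap R A n} → I.IsPrincipal := by
  -- A principal factor containing I can be cancelled: I' consists of the z with p * z ∈ I.
  have key : ∀ (p : A) (a : A) (I J : Ideal A), p ≠ 0 → I ≤ Ideal.span {p} →
      I * J = Ideal.span {p * a} →
      ∃ I', I = Ideal.span {p} * I' ∧ I' * J = Ideal.span {a} := by
    intro p a I J hp hI hIJ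
    refine ⟨Submodule.comap (LinearMap.mulLeft A p) I, ?_, ?_⟩
    · ext x
      rw [Ideal.mem_span_singleton_mul]
      constructor
      · intro hx
        obtain ⟨z, rfl⟩ := Ideal.mem_span_singleton.mp (hI hx)
        exact ⟨z, hx, rfl⟩
      · rintro ⟨z, hz, rfl⟩
        exact hz
    · rw [← Ideal.span_singleton_mul_right_inj hp, ← mul_assoc,
        Ideal.span_singleton_mul_span_singleton, ← hIJ]
      congr 1
      ext x
      rw [Ideal.mem_span_singleton_mul]
      constructor
      · rintro ⟨z, hz, rfl⟩
        exact hz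
      · intro hx
        obtain ⟨z, rfl⟩ := Ideal.mem_span_singleton.mp (hI hx)
        exact ⟨z, hx, rfl⟩
  induction n using UniqueFactorizationMonoid.induction_on_prime with
  | h₁ => exact fun h => absurd rfl h
  | h₂ x hx =>
    intro _ I J h
    have htop : Ideal.span {algebraMap R A x} = ⊤ :=
      Ideal.span_singleton_eq_top.mpr (hx.map (algebraMap R A))
    have : I = ⊤ := top_le_iff.mp (htop ▸ h ▸ Ideal.mul_le_left)
    rw [this]
    exact ⟨1, by simp⟩
  | h₃ a p ha hp ih =>
    intro _ I J h
    have hq := hprime p hp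
    rw [map_mul] at h
    have hle : I * J ≤ Ideal.span {algebraMap R A p} := by
      rw [h, Ideal.span_singleton_le_span_singleton]
      exact dvd_mul_right _ _
    -- The prime p contains I or J; cancel it from that factor and induct.
    rcases (((Ideal.span_singleton_prime hq.ne_zero).mpr hq).mul_le).mp hle with hI | hJ
    · obtain ⟨I', rfl, h'⟩ := key _ _ _ _ hq.ne_zero hI h
      obtain ⟨z, hz⟩ := (ih ha I' J h').principal
      exact ⟨algebraMap R A p * z, by
        rw [hz]; exact Ideal.span_singleton_mul_span_singleton _ _⟩
    · obtain ⟨J', -, h'⟩ := key _ _ _ _ hq.ne_zero hJ ((mul_comm J I).trans h)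
      exact ih ha I J' ((mul_comm I J').trans h')

/-- Inside the fraction field, a⁻¹J is an inverse of I. -/
theorem Module.Invertible.of_ideal_mul_eq_span {A : Type*} [CommRing A] [IsDomain A]
    {I J : Ideal A} {a : A} (ha : a ≠ 0) (h : I * J = Ideal.span {a}) :
    Module.Invertible A I := by
  let F := FractionRing A
  have haF : algebraMap A F a ≠ 0 := by simpa using ha
  have hinj : Function.Injective (Algebra.linearMap A F) := FaithfulSMul.algebraMap_injective A F
  have hmul : Submodule.map (Algebra.linearMap A F) I *
      (Submodule.span A {(algebraMap A F a)⁻¹} * Submodule.map (Algebra.linearMap A F) J) = 1 := by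
    have h' : Submodule.map (Algebra.linearMap A F) (I * J) =
        Submodule.map (Algebra.linearMap A F) I * Submodule.map (Algebra.linearMap A F) J :=
      Submodule.map_mul I J (Algebra.ofId A F)
    rw [mul_left_comm, ← h', h, Ideal.span, LinearMap.map_span, Set.image_singleton,
      Submodule.span_mul_span, Submodule.one_eq_span,
      Set.singleton_mul_singleton, Algebra.linearMap_apply, inv_mul_cancel₀ haF]
  let U : (Submodule A F)ˣ := Units.mkOfMulEqOne _ _ hmul
  have e : I ≃ₗ[A] U.1 := Submodule.equivMapOfInjective (Algebra.linearMap A F) hinj I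
  exact .congr e.symm

/-! ### Ideals that are locally principal -/

namespace Ideal

/-- `I` becomes principal, generated by an element of `I`, after inverting some element outside
of `P`. -/
def IsPrincipalNear {A : Type*} [CommRing A] (I P : Ideal A) : Prop :=
  ∃ b ∈ I, ∃ r ∉ P, ∀ x ∈ I, b ∣ r * x

variable {A : Type*} [CommRing A]

/-- Some product x * y with x ∈ I, y ∈ J must equal a * r with r ∉ P, since otherwise a ∈ aP; such
an x generates I near P. -/
theorem isPrincipalNear_of_mul_eq_span [IsDomain A] {I J P : Ideal A} {a : A} (ha : a ≠ 0)
    (h : I * J = span {a}) (hP : P ≠ ⊤) : I.IsPrincipalNear P := by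
  by_contra hcon
  have hle : I * J ≤ span {a} * P := by
    rw [mul_le]
    intro x hx y hy
    obtain ⟨r, hr⟩ := mem_span_singleton.mp (h ▸ mul_mem_mul hx hy : x * y ∈ span {a})
    rw [mem_span_singleton_mul]
    refine ⟨r, ?_, hr.symm⟩
    by_contra hrP
    refine hcon ⟨x, hx, r, hrP, fun z hz => ?_⟩
    obtain ⟨s, hs⟩ := mem_span_singleton.mp (h ▸ mul_mem_mul hz hy : z * y ∈ span {a})
    refine ⟨s, mul_left_cancel₀ ha ?_⟩
    linear_combination -z * hr + x * hs
  have hmem : a ∈ span {a} * P := hle (h ▸ mem_span_singleton_self a)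
  obtain ⟨r, hr, hra⟩ := mem_span_singleton_mul.mp hmem
  have : r = 1 := mul_left_cancel₀ ha (by rw [hra, mul_one])
  exact hP ((eq_top_iff_one P).mpr (this ▸ hr))

theorem exists_mul_eq_span_of_isPrincipalNear [IsDomain A] {I : Ideal A} (hI : I ≠ ⊥)
    (h : ∀ m : Ideal A, m.IsMaximal → I.IsPrincipalNear m) :
    ∃ (J : Ideal A) (a : A), a ≠ 0 ∧ I * J = span {a} := by
  obtain ⟨a, haI, ha⟩ := Submodule.exists_mem_ne_zero_of_ne_bot hI
  let J : Ideal A := (span {a}).colon I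
  have hJ : ∀ y, y ∈ J ↔ ∀ x ∈ I, a ∣ y * x := fun y => by
    simp [J, Submodule.mem_colon, mem_span_singleton]
  refine ⟨J, a, ha, le_antisymm ?_ ?_⟩
  · rw [mul_le]
    intro x hx y hy
    rw [mem_span_singleton, mul_comm]
    exact (hJ y).mp hy x hx
  · rw [span_singleton_le_iff_mem]
    by_contra hcon
    -- The z with z * a ∈ I * J form a proper ideal, inside some m. But near m the generator b gives
    -- r * a = b * s with s ∈ J, and r ∉ m.
    obtain ⟨m, hm, hle⟩ := exists_le_maximal (Submodule.comap (LinearMap.mulRight A a) (I * J)) (by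
      rw [Ne, eq_top_iff_one]
      simpa using hcon)
    obtain ⟨b, hb, r, hr, hdvd⟩ := h m hm
    refine hr (hle ?_)
    obtain ⟨s, hs⟩ := hdvd a haI
    have hr0 : r ≠ 0 := fun h0 => hr (h0 ▸ m.zero_mem)
    have hb0 : b ≠ 0 := by
      rintro rfl
      exact mul_ne_zero hr0 ha (by rw [hs, zero_mul])
    change r * a ∈ I * J
    rw [hs]
    refine mul_mem_mul hb ((hJ s).mpr fun x hx => ?_)
    obtain ⟨t, ht⟩ := hdvd x hx
    refine ⟨t, mul_left_cancel₀ hb0 ?_⟩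
    linear_combination a * ht - x * hs

/-- Nakayama's lemma. -/
theorem isPrincipalNear_of_forall_mul_mem_sup {I m : Ideal A} (hI : I.FG) (hm : m.IsMaximal)
    {b s : A} (hb : b ∈ I) (hs : s ∉ m) (h : ∀ x ∈ I, s * x ∈ span {b} ⊔ m * I) :
    I.IsPrincipalNear m := by
  obtain ⟨t, n, hn, ht⟩ := hm.exists_inv hs
  have hle : I ≤ span {b} ⊔ m * I := fun x hx => by
    have hx' : x = t * (s * x) + n * x := by linear_combination -x * ht
    rw [hx']
    exact add_mem (mul_mem_left _ _ (h x hx)) (mem_sup_right (mul_mem_mul hn hx))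
  -- Modulo b the hypothesis reads N ≤ mN, so some r ≡ 1 mod m kills N.
  let N : Submodule A (A ⧸ span {b}) := Submodule.map (Submodule.mkQ (span {b})) I
  have hN : N ≤ m • N := by
    rw [← Submodule.map_smul'']
    refine (Submodule.map_mono hle).trans ?_
    rw [Submodule.map_sup]
    refine sup_le ?_ le_rfl
    simp
  obtain ⟨r, hr, hr0⟩ :=
    Submodule.exists_sub_one_mem_and_smul_eq_zero_of_fg_of_le_smul m N (Submodule.FG.map _ hI) hN
  refine ⟨b, hb, r, fun hrm => ?_, fun x hx => ?_⟩
  · refine hm.ne_top ((eq_top_iff_one m).mpr ?_)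
    simpa using sub_mem hrm hr
  · have := hr0 (Submodule.mkQ (span {b}) x) (Submodule.mem_map_of_mem hx)
    rw [← map_smul, Submodule.mkQ_apply, Submodule.Quotient.mk_eq_zero] at this
    exact mem_span_singleton.mp this

/-- Elements of M avoid m, so clearing denominators is harmless near m; finite generation makes one
denominator serve for the whole ideal. -/
theorem IsPrincipalNear.comap_of_isLocalization {B : Type*} [CommRing B] [Algebra A B]
    (M : Submonoid A) [IsLocalization M B] [FaithfulSMul A B] {m : Ideal A} [hm : m.IsPrime]
    (hdisj : Disjoint (M : Set A) m) {I : Ideal B} (hfg : (I.comap (algebraMap A B)).FG)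
    (h : I.IsPrincipalNear (m.map (algebraMap A B))) :
    (I.comap (algebraMap A B)).IsPrincipalNear m := by
  have hinj : Function.Injective (algebraMap A B) := FaithfulSMul.algebraMap_injective A B
  obtain ⟨b, hb, r, hr, hdvd⟩ := h
  obtain ⟨⟨b', d⟩, hbd⟩ := IsLocalization.surj M b
  obtain ⟨⟨r', e⟩, hre⟩ := IsLocalization.surj M r
  have hnot : ∀ d ∈ M, d ∉ m := fun d hd hdm => Set.disjoint_left.mp hdisj hd hdm
  have hr' : r' ∉ m := fun hr'm => hr (by
    have := mem_map_of_mem (algebraMap A B) hr'm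
    rw [← hre] at this
    exact ((m.map _).mul_unit_mem_iff_mem (IsLocalization.map_units B e)).mp this)
  have hb' : algebraMap A B b' ∈ I := hbd ▸ I.mul_mem_right _ hb
  have hstep : ∀ x ∈ I.comap (algebraMap A B), ∃ c ∈ M, b' ∣ c * (r' * x) := by
    intro x hx
    obtain ⟨y, hy⟩ := hdvd _ hx
    obtain ⟨⟨y', c⟩, hyc⟩ := IsLocalization.surj M y
    refine ⟨c * d, mul_mem c.2 d.2, y' * e, hinj ?_⟩
    simp only [map_mul]
    rw [← hre, ← hbd, ← hyc]
    linear_combination (algebraMap A B e * algebraMap A B c * algebraMap A B d) * hy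
  have hunif : ∃ c ∈ M, ∀ x ∈ I.comap (algebraMap A B), b' ∣ c * (r' * x) := by
    obtain ⟨s, hs⟩ := hfg
    classical
    choose! c hcM hc using hstep
    have hsub : ∀ x ∈ s, x ∈ I.comap (algebraMap A B) := fun x hx => hs ▸ subset_span hx
    refine ⟨∏ x ∈ s, c x, Submonoid.prod_mem _ fun x hx => hcM x (hsub x hx), fun x hx => ?_⟩
    rw [← hs] at hx
    induction hx using Submodule.span_induction with
    | mem x hx =>
      rw [← Finset.mul_prod_erase s c hx]
      exact (hc x (hsub x hx)).trans ⟨∏ x ∈ s.erase x, c x, by ring⟩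
    | zero => simp
    | add x y _ _ hx hy => rw [mul_add, mul_add]; exact dvd_add hx hy
    | smul a x _ hx =>
      rw [smul_eq_mul, mul_left_comm r', mul_left_comm]
      exact hx.mul_left a
  obtain ⟨c, hc, hcdvd⟩ := hunif
  exact ⟨b', hb', c * r', hm.mul_notMem (hnot c hc) hr', fun x hx => by
    rw [mul_assoc]; exact hcdvd x hx⟩

end Ideal

/-! ### Lifting local generators from the fibres -/

namespace Ideal

theorem isPrincipalNear_of_isDedekindDomain {D : Type*} [CommRing D] [IsDedekindDomain D]
    (I P : Ideal D) (hP : P ≠ ⊤) : I.IsPrincipalNear P := by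
  by_cases hI : I = ⊥
  · exact ⟨0, I.zero_mem, 1, (ne_top_iff_one P).mp hP, fun x hx => by simp_all⟩
  · obtain ⟨a, haI, ha⟩ := Submodule.exists_mem_ne_zero_of_ne_bot hI
    obtain ⟨J, hJ⟩ := dvd_span_singleton.mpr haI
    exact isPrincipalNear_of_mul_eq_span ha hJ.symm hP

variable {R A B : Type*} [CommRing R] [CommRing A] [CommRing B] [Algebra R A] [Algebra A B]
  [IsDomain A] [FaithfulSMul A B] [IsNoetherianRing A]

omit [IsDomain A] [FaithfulSMul A B] in
/-- The contraction of an ideal from the generic fibre is principal near every point at which the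
special fibre is a Dedekind domain. -/
theorem isPrincipalNear_comap_of_fibre [IsDedekindDomain R]
    [IsLocalization (Algebra.algebraMapSubmonoid A R⁰) B] (I : Ideal B)
    {m : Ideal A} (hm : m.IsMaximal) (hne : m.comap (algebraMap R A) ≠ ⊥)
    {D : Type*} [CommRing D] [IsDedekindDomain D] (π : A →+* D) (hπ : Function.Surjective π)
    (hker : RingHom.ker π = (m.comap (algebraMap R A)).map (algebraMap R A)) :
    (I.comap (algebraMap A B)).IsPrincipalNear m := by
  set p := m.comap (algebraMap R A) with hp
  set I' := I.comap (algebraMap A B) with hI'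
  have hpt : p ≠ ⊤ := comap_ne_top _ hm.ne_top
  have hkm : RingHom.ker π ≤ m := hker ▸ map_comap_le
  -- ϖ generates p once t is inverted, as a uniformizer would.
  obtain ⟨ϖ, hϖ, t, ht, htdvd⟩ := isPrincipalNear_of_isDedekindDomain p p hpt
  have hmD : (m.map π) ≠ ⊤ := by
    intro h
    have := comap_map_of_surjective' π hπ m
    rw [h, comap_top, sup_eq_left.mpr hkm] at this
    exact hm.ne_top this.symm
  obtain ⟨b₀, hb₀, c₀, hc₀, hdvd⟩ := isPrincipalNear_of_isDedekindDomain (I'.map π) (m.map π) hmD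
  obtain ⟨b, hb, rfl⟩ := (mem_map_iff_of_surjective π hπ).mp hb₀
  obtain ⟨c, rfl⟩ := hπ c₀
  have hc : c ∉ m := fun h => hc₀ (mem_map_of_mem π h)
  have htm : algebraMap R A t ∉ m := ht
  have hϖ0 : ϖ ≠ 0 := by
    rintro rfl
    obtain ⟨y, hy, hy0⟩ := Submodule.exists_mem_ne_zero_of_ne_bot hne
    have h0 := zero_dvd_iff.mp (htdvd y hy)
    rcases mul_eq_zero.mp h0 with h | h
    · exact ht (h ▸ p.zero_mem)
    · exact hy0 h
  have hunit : IsUnit (algebraMap A B (algebraMap R A ϖ)) :=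
    IsLocalization.map_units B
      (⟨_, ϖ, mem_nonZeroDivisors_of_ne_zero hϖ0, rfl⟩ : Algebra.algebraMapSubmonoid A R⁰)
  have htker : ∀ x ∈ RingHom.ker π, algebraMap R A ϖ ∣ algebraMap R A t * x := by
    intro x hx
    rw [hker] at hx
    induction hx using Submodule.span_induction with
    | mem x hx =>
      obtain ⟨y, hy, rfl⟩ := hx
      rw [← map_mul]
      exact map_dvd (algebraMap R A) (htdvd y hy)
    | zero => simp
    | add x y _ _ hx hy => rw [mul_add]; exact dvd_add hx hy
    | smul a x _ hx => rw [smul_eq_mul, mul_left_comm]; exact hx.mul_left a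
  refine isPrincipalNear_of_forall_mul_mem_sup (IsNoetherian.noetherian I') hm hb
    (hm.isPrime.mul_notMem htm hc) fun x hx => ?_
  obtain ⟨z₀, hz₀⟩ := hdvd _ (mem_map_of_mem π hx)
  obtain ⟨z, rfl⟩ := hπ z₀
  have hk : c * x - b * z ∈ RingHom.ker π := by
    rw [RingHom.mem_ker, map_sub, map_mul, map_mul, hz₀, sub_self]
  obtain ⟨w, hw⟩ := htker _ hk
  -- Saturation: ϖ is a unit in B and I' is contracted from B, so ϖ * w ∈ I' forces w ∈ I'.
  have hwI : w ∈ I' := by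
    have hmem : algebraMap R A ϖ * w ∈ I' :=
      hw ▸ I'.mul_mem_left _ (sub_mem (I'.mul_mem_left _ hx) (I'.mul_mem_right _ hb))
    have h2 : algebraMap A B (algebraMap R A ϖ) * algebraMap A B w ∈ I := by
      rw [← map_mul]; exact hmem
    exact (I.unit_mul_mem_iff_mem hunit).mp h2
  have heq : algebraMap R A t * c * x = b * (algebraMap R A t * z) + algebraMap R A ϖ * w := by
    linear_combination hw
  rw [heq]
  exact add_mem (mem_sup_left (mem_span_singleton.mpr ⟨_, rfl⟩))
    (mem_sup_right (mul_mem_mul hϖ hwI))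

end Ideal

/-! ### Picard groups of A and of its generic fibre -/

namespace CommRing.Pic

variable {R A B : Type*} [CommRing R] [CommRing A] [CommRing B] [Algebra R A] [Algebra A B]
  [IsDomain A] [FaithfulSMul A B]

omit [IsDomain A] [FaithfulSMul A B] in
theorem mapAlgebra_mk (M : Type*) [AddCommGroup M] [Module A M] [Module.Invertible A M] :
    mapAlgebra A B (Pic.mk A M) = Pic.mk B (B ⊗[A] M) := by
  rw [mapAlgebra_apply, mk_eq_mk_iff]
  exact ⟨TensorProduct.AlgebraTensorModule.congr (.refl ..) (mk.linearEquiv ..)⟩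

/-- The Picard group of the fraction field is trivial, so every class comes from an invertible
submodule of that field, and denominators can be cleared. -/
theorem exists_mul_eq_span_mk_eq [IsDomain B] (N : Pic B) :
    ∃ (I J : Ideal B) (a : B) (_ : Module.Invertible B I),
      a ≠ 0 ∧ I * J = Ideal.span {a} ∧ Pic.mk B I = N := by
  have hN : N ∈ relPic B (FractionRing B) := Subsingleton.elim ..
  rw [← Submodule.range_unitsToPic] at hN
  obtain ⟨U, rfl⟩ := hN
  obtain ⟨I, J, a, ha, h, ⟨e⟩⟩ := Submodule.exists_ideal_mul_eq_span B⁰ U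
  exact ⟨I, J, a, .congr e, nonZeroDivisors.ne_zero ha, h, by
    have : Module.Invertible B I := .congr e
    rw [Submodule.unitsToPic_apply, mk_eq_mk_iff]; exact ⟨e.symm⟩⟩

/-- The kernel is `relPic A B`, the classes of invertible A-submodules of B. Their denominators come
from R, so each is an ideal dividing an element of R. -/
theorem mapAlgebra_injective [IsDomain R] [UniqueFactorizationMonoid R]
    [FaithfulSMul R A] [IsLocalization (Algebra.algebraMapSubmonoid A R⁰) B]
    (hprime : ∀ p : R, Prime p → Prime (algebraMap R A p)) :
    Function.Injective (mapAlgebra A B) := by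
  rw [injective_iff_map_eq_one]
  intro N hN
  have hN : N ∈ relPic A B := hN
  rw [← Submodule.range_unitsToPic] at hN
  obtain ⟨U, rfl⟩ := hN
  obtain ⟨I, J, _, ⟨n, hn, rfl⟩, h, ⟨e⟩⟩ :=
    Submodule.exists_ideal_mul_eq_span (Algebra.algebraMapSubmonoid A R⁰) U
  have hn0 : n ≠ 0 := nonZeroDivisors.ne_zero hn
  obtain ⟨x, hx⟩ := (Ideal.isPrincipal_of_mul_eq_span_algebraMap hprime n hn0 I J h).principal
  have hx0 : x ≠ 0 := by
    rintro rfl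
    rw [hx, Submodule.span_singleton_eq_bot.mpr rfl, Ideal.bot_mul, eq_comm,
      Ideal.span_singleton_eq_bot] at h
    exact hn0 ((map_eq_zero_iff _ (FaithfulSMul.algebraMap_injective R A)).mp h)
  rw [Submodule.unitsToPic_apply, mk_eq_one_iff]
  exact ⟨e ≪≫ₗ LinearEquiv.ofEq _ _ hx ≪≫ₗ (LinearEquiv.toSpanNonzeroSingleton A A x hx0).symm⟩

universe v in
/-- If the fibres of `A` over the nonzero primes of a Dedekind domain `R` are Dedekind domains,
then every invertible module over the generic fibre extends to an invertible module over `A`. -/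
theorem mapAlgebra_surjective [IsDedekindDomain R] [IsDomain B] [FaithfulSMul R A]
    [IsNoetherianRing A] [IsLocalization (Algebra.algebraMapSubmonoid A R⁰) B]
    (hfibre : ∀ p : Ideal R, p.IsPrime → p ≠ ⊥ →
      ∃ (D : Type v) (_ : CommRing D) (_ : IsDedekindDomain D) (π : A →+* D),
        Function.Surjective π ∧ RingHom.ker π = p.map (algebraMap R A)) :
    Function.Surjective (mapAlgebra A B) := by
  intro N
  obtain ⟨I, J, a, hI, ha, h, rfl⟩ := exists_mul_eq_span_mk_eq N
  let M := Algebra.algebraMapSubmonoid A R⁰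
  have hmap : (I.comap (algebraMap A B)).map (algebraMap A B) = I :=
    IsLocalization.map_under M B I
  have hI0 : I.comap (algebraMap A B) ≠ ⊥ := by
    intro h0
    rw [h0, Ideal.map_bot] at hmap
    rw [← hmap, Ideal.bot_mul, eq_comm, Ideal.span_singleton_eq_bot] at h
    exact ha h
  obtain ⟨J', a', ha', h'⟩ := Ideal.exists_mul_eq_span_of_isPrincipalNear hI0 (by
    intro m hm
    by_cases hne : m.comap (algebraMap R A) = ⊥
    -- Here m lies over 0, so it survives in B, where I is locally principal.
    · have hdisj : Disjoint (M : Set A) m := by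
        rw [Set.disjoint_left]
        rintro _ ⟨r, hr, rfl⟩ hrm
        have hr' : r ∈ m.comap (algebraMap R A) := hrm
        rw [hne] at hr'
        exact nonZeroDivisors.ne_zero hr hr'
      have := hm.isPrime
      refine Ideal.IsPrincipalNear.comap_of_isLocalization M hdisj (IsNoetherian.noetherian _)
        (Ideal.isPrincipalNear_of_mul_eq_span ha h ?_)
      exact (IsLocalization.isPrime_of_isPrime_disjoint M B m hm.isPrime hdisj).ne_top
    · have := hm.isPrime
      obtain ⟨D, _, _, π, hπ, hker⟩ := hfibre _ (Ideal.comap_isPrime (algebraMap R A) m) hne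
      exact Ideal.isPrincipalNear_comap_of_fibre (R := R) I hm hne π hπ hker)
  have : Module.Invertible A (I.comap (algebraMap A B)) := .of_ideal_mul_eq_span ha' h'
  refine ⟨Pic.mk A (I.comap (algebraMap A B)), ?_⟩
  rw [mapAlgebra_mk, mk_eq_mk_iff]
  let f := Submodule.toLocalized' (S := B) M (Algebra.linearMap A B) (I.comap (algebraMap A B))
  have hbc : IsBaseChange B f := (isLocalizedModule_iff_isBaseChange M B f).mp inferInstance
  refine ⟨hbc.equiv ≪≫ₗ LinearEquiv.ofEq _ _ ?_⟩
  rw [Submodule.localized'_eq_span]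
  exact hmap

end CommRing.Pic

/-! ### Quadratic extensions -/

namespace AdjoinRoot

section Quadratic

variable {D : Type*} [CommRing D] (g : D)

theorem monic_X_sq_sub_C : ((X : D[X]) ^ 2 - C g).Monic :=
  monic_X_pow_sub_C g two_ne_zero

variable {g}

theorem root_sq : root ((X : D[X]) ^ 2 - C g) ^ 2 = of _ g := by
  have h := eval₂_root ((X : D[X]) ^ 2 - C g)
  simpa [sub_eq_zero] using h

theorem exists_of_add_of_mul_root (z : AdjoinRoot ((X : D[X]) ^ 2 - C g)) :
    ∃ a b : D, z = of _ a + of _ b * root _ := by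
  obtain ⟨p, rfl⟩ := mk_surjective z
  rcases subsingleton_or_nontrivial D with _ | _
  · exact ⟨0, 0, by rw [Subsingleton.elim p 0]; simp⟩
  have hdeg : (p %ₘ (X ^ 2 - C g)).degree < 2 := by
    have := degree_modByMonic_lt p (monic_X_sq_sub_C g)
    rwa [degree_X_pow_sub_C two_pos] at this
  refine ⟨(p %ₘ (X ^ 2 - C g)).coeff 0, (p %ₘ (X ^ 2 - C g)).coeff 1, ?_⟩
  conv_lhs => rw [← mk_leftInverse (monic_X_sq_sub_C g) (mk _ p), modByMonicHom_mk,
    eq_X_add_C_of_degree_le_one (Order.le_of_lt_succ hdeg)]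
  rw [map_add, map_mul, mk_C, mk_C, mk_X, add_comm]

theorem of_add_of_mul_root_eq_zero_iff {a b : D} :
    of ((X : D[X]) ^ 2 - C g) a + of _ b * root _ = 0 ↔ a = 0 ∧ b = 0 := by
  refine ⟨fun h => ?_, by rintro ⟨rfl, rfl⟩; simp⟩
  nontriviality D
  have hmk : mk ((X : D[X]) ^ 2 - C g) (C b * X + C a) = 0 := by
    rw [map_add, map_mul, mk_C, mk_C, mk_X, add_comm, h]
  have h0 : C b * X + C a = 0 := by
    by_contra hne
    refine mk_ne_zero_of_degree_lt (monic_X_sq_sub_C g) hne ?_ hmk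
    rw [degree_X_pow_sub_C two_pos]
    exact degree_linear_lt
  have h1 := congrArg (coeff · 1) h0
  have h2 := congrArg (coeff · 0) h0
  simp at h1 h2
  exact ⟨h2, h1⟩

theorem of_sub_mul_of_add (a b : D) :
    (of ((X : D[X]) ^ 2 - C g) a - of _ b * root _) * (of _ a + of _ b * root _) =
      of _ (a ^ 2 - g * b ^ 2) := by
  simp only [map_sub, map_mul, map_pow, ← root_sq]
  ring

/-- A quadratic extension in which only zero has norm zero is a domain. -/
theorem isDomain_X_sq_sub_C [IsDomain D]
    (hg : ∀ a b : D, a ^ 2 - g * b ^ 2 = 0 → a = 0 ∧ b = 0) :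
    IsDomain (AdjoinRoot ((X : D[X]) ^ 2 - C g)) := by
  have : Nontrivial (AdjoinRoot ((X : D[X]) ^ 2 - C g)) := by
    refine ⟨0, 1, fun h => ?_⟩
    have := (of_add_of_mul_root_eq_zero_iff (g := g) (a := 1) (b := 0)).mp (by rw [map_one, map_zero, zero_mul, add_zero, h])
    exact one_ne_zero this.1
  have : NoZeroDivisors (AdjoinRoot ((X : D[X]) ^ 2 - C g)) := by
    refine ⟨fun {z w} h => or_iff_not_imp_left.mpr fun hz => ?_⟩
    obtain ⟨a, b, rfl⟩ := exists_of_add_of_mul_root z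
    obtain ⟨c, d, rfl⟩ := exists_of_add_of_mul_root w
    set n := a ^ 2 - g * b ^ 2
    have hn : n ≠ 0 := fun hn => hz (of_add_of_mul_root_eq_zero_iff.mpr (hg a b hn))
    have hnw : of ((X : D[X]) ^ 2 - C g) (n * c) + of _ (n * d) * root _ = 0 := by
      rw [map_mul, map_mul, ← of_sub_mul_of_add]
      linear_combination (of _ a - of _ b * root _) * h
    obtain ⟨h1, h2⟩ := of_add_of_mul_root_eq_zero_iff.mp hnw
    rw [mul_eq_zero, or_iff_right hn] at h1 h2
    simp [h1, h2]
  exact NoZeroDivisors.to_isDomain _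

end Quadratic

end AdjoinRoot

/-- From n² ∣ (g * b)² comes g * b = n * e; then g ∣ e², so g ∣ e as g is square-free, and g
cancels. -/
theorem dvd_of_mul_self_dvd_mul_mul_self {D : Type*} [CommRing D] [IsDomain D]
    [IsPrincipalIdealRing D] {g n b : D} (hg : Squarefree g) (hg0 : g ≠ 0)
    (h : n ^ 2 ∣ g * b ^ 2) : n ∣ b := by
  by_cases hn : n = 0
  · subst hn
    simp_all
  have h1 : n ∣ g * b := by
    rw [← IsIntegrallyClosed.pow_dvd_pow_iff two_ne_zero]
    exact h.trans ⟨g, by ring⟩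
  obtain ⟨e, he⟩ := h1
  obtain ⟨s, hs⟩ := h
  have h2 : g ∣ e ^ 2 := by
    refine ⟨s, mul_left_cancel₀ (pow_ne_zero 2 hn) ?_⟩
    linear_combination g * hs - (g * b + n * e) * he
  obtain ⟨t, rfl⟩ := hg.isRadical 2 e h2
  exact ⟨t, mul_left_cancel₀ hg0 (by linear_combination he)⟩

/-- The element w is the fraction e / n, and an integral fraction lies in D. -/
theorem IsIntegral.dvd_of_mul_eq {D F : Type*} [CommRing D] [IsDomain D] [IsIntegrallyClosed D]
    [Field F] [Algebra D F] [FaithfulSMul D F] {n e : D} {w : F} (hn : n ≠ 0)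
    (hw : IsIntegral D w) (h : algebraMap D F n * w = algebraMap D F e) : n ∣ e := by
  let := FractionRing.liftAlgebra D F
  have := FractionRing.isScalarTower_liftAlgebra D F
  let K := FractionRing D
  have hnK : algebraMap D K n ≠ 0 := by simpa using hn
  have hnF : algebraMap D F n ≠ 0 := by simpa using hn
  have hw' : algebraMap K F (algebraMap D K e / algebraMap D K n) = w := by
    rw [map_div₀, ← IsScalarTower.algebraMap_apply, ← IsScalarTower.algebraMap_apply, ← h,
      mul_div_cancel_left₀ _ hnF]
  rw [← hw', isIntegral_algebraMap_iff (algebraMap K F).injective] at hw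
  obtain ⟨y, hy⟩ := IsIntegrallyClosed.isIntegral_iff.mp hw
  refine ⟨y, FaithfulSMul.algebraMap_injective D K ?_⟩
  rw [map_mul, hy, mul_div_cancel₀ _ hnK]

namespace AdjoinRoot

/-- A quadratic extension `D[√g]` of a principal ideal domain in which `2` is invertible is
a Dedekind domain if `g` is square-free. -/
theorem isDedekindDomain_X_sq_sub_C {D : Type*} [CommRing D] [IsDomain D]
    [IsPrincipalIdealRing D] {g : D} (h2 : IsUnit (2 : D)) (hg : Squarefree g) (hg0 : g ≠ 0)
    (hdom : IsDomain (AdjoinRoot ((X : D[X]) ^ 2 - C g))) :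
    IsDedekindDomain (AdjoinRoot ((X : D[X]) ^ 2 - C g)) := by
  let A := AdjoinRoot ((X : D[X]) ^ 2 - C g)
  let F := FractionRing A
  let y : A := root _
  have hinj : Function.Injective (algebraMap D A) := by
    rw [injective_iff_map_eq_zero]
    intro a ha
    refine (of_add_of_mul_root_eq_zero_iff (g := g) (a := a) (b := 0)).mp ?_ |>.1
    rw [map_zero, zero_mul, add_zero]
    exact ha
  have : FaithfulSMul D A := (faithfulSMul_iff_algebraMap_injective D A).mpr hinj
  have : FaithfulSMul D F := .trans D A F
  have : Module.Finite D A := Module.Finite.of_basis (powerBasis' (monic_X_sq_sub_C g)).basis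
  have : Ring.DimensionLEOne A := .of_isIntegral D A
  let σ : A →ₐ[D] A := liftAlgHom _ (Algebra.ofId D A) (-y) (by
    have := root_sq (g := g)
    simp only [eval₂_sub, eval₂_pow, eval₂_X, eval₂_C, neg_sq]
    exact sub_eq_zero.mpr this)
  have hσy : σ y = -y := liftAlgHom_root _ _ _ _
  have hσσ : ∀ z, σ (σ z) = z := by
    intro z
    have : σ.comp σ = AlgHom.id D A := by
      apply AdjoinRoot.algHom_ext
      change σ (σ y) = y
      rw [hσy, map_neg, hσy, neg_neg]
    exact DFunLike.congr_fun this z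
  have hσinj : Function.Injective ((IsScalarTower.toAlgHom D A F).comp σ) :=
    (FaithfulSMul.algebraMap_injective A F).comp (Function.LeftInverse.injective hσσ)
  let τ : F →ₐ[D] F := IsFractionRing.liftAlgHom (K := F) hσinj
  have hτ : ∀ z : A, τ (algebraMap A F z) = algebraMap A F (σ z) := fun z =>
    IsFractionRing.lift_algebraMap (K := F) hσinj z
  have hyy : algebraMap A F y ^ 2 = algebraMap D F g := by
    rw [← map_pow, IsScalarTower.algebraMap_apply D A F]
    exact congrArg _ root_sq
  have : IsIntegrallyClosed A := by
    rw [isIntegrallyClosed_iff F]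
    intro x hx
    have hxD : IsIntegral D x := isIntegral_trans x hx
    obtain ⟨α, β, hβ, rfl⟩ := IsFractionRing.div_surjective (A := A) x
    obtain ⟨c, d, rfl⟩ := exists_of_add_of_mul_root β
    -- Multiplying by the conjugate of β writes x as (a + b * y) / n, with n ∈ D the norm of β.
    obtain ⟨a, b, hab⟩ := exists_of_add_of_mul_root (α * (of _ c - of _ d * root _))
    have hβ0 := nonZeroDivisors.ne_zero hβ
    set β : A := of _ c + of _ d * root _ with hβdef
    set n := c ^ 2 - g * d ^ 2
    have hn : algebraMap A F β * algebraMap A F (of _ c - of _ d * root _) = algebraMap D F n := by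
      rw [← map_mul, mul_comm, of_sub_mul_of_add, IsScalarTower.algebraMap_apply D A F]
      rfl
    have hβF : algebraMap A F β ≠ 0 := by simpa using hβ0
    have hn0 : n ≠ 0 := by
      intro h0
      rw [h0, map_zero, mul_eq_zero, or_iff_right hβF, map_eq_zero_iff _
        (FaithfulSMul.algebraMap_injective A F), sub_eq_add_neg, ← neg_mul, ← map_neg,
        of_add_of_mul_root_eq_zero_iff, neg_eq_zero] at hn
      exact hβ0 (of_add_of_mul_root_eq_zero_iff.mpr hn)
    set x := algebraMap A F α / algebraMap A F β with hxdef
    have hnx : algebraMap D F n * x = algebraMap D F a + algebraMap D F b * algebraMap A F y := by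
      have h3 : algebraMap A F (α * (of _ c - of _ d * root _)) =
          algebraMap D F a + algebraMap D F b * algebraMap A F y := by
        rw [hab, map_add, map_mul, IsScalarTower.algebraMap_apply D A F,
          IsScalarTower.algebraMap_apply D A F]
        rfl
      rw [← h3, ← hn, map_mul, hxdef]
      rw [mul_comm (algebraMap A F α), mul_right_comm, mul_div_cancel₀ _ hβF, mul_comm]
    have hnτx : algebraMap D F n * τ x =
        algebraMap D F a - algebraMap D F b * algebraMap A F y := by
      have := congrArg τ hnx
      rw [map_mul, map_add, map_mul, AlgHom.commutes, AlgHom.commutes, AlgHom.commutes, hτ, hσy,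
        map_neg] at this
      rw [this]; ring
    -- The trace x + τ x is integral and equals 2a / n; 2 is a unit.
    have hna : n ∣ a := by
      rw [← h2.dvd_mul_left (u := 2)]
      refine IsIntegral.dvd_of_mul_eq hn0 (hxD.add (hxD.map τ)) ?_
      rw [map_mul, map_ofNat]
      linear_combination hnx + hnτx
    obtain ⟨a', rfl⟩ := hna
    -- The square of x - a' is integral and equals g * b² / n².
    have hnb : n ∣ b := by
      refine dvd_of_mul_self_dvd_mul_mul_self hg hg0 ?_
      refine IsIntegral.dvd_of_mul_eq (w := (x - algebraMap D F a') ^ 2) (pow_ne_zero 2 hn0)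
        ((hxD.sub isIntegral_algebraMap).pow 2) ?_
      rw [map_mul, map_pow, map_pow, ← hyy, ← mul_pow, ← mul_pow]
      rw [map_mul] at hnx
      congr 1
      linear_combination hnx
    obtain ⟨b', rfl⟩ := hnb
    refine ⟨of _ a' + of _ b' * root _, ?_⟩
    have hnF : algebraMap D F n ≠ 0 := by simpa using hn0
    refine mul_left_cancel₀ hnF ?_
    rw [hnx, map_add, map_mul]
    change algebraMap D F n * (algebraMap A F (algebraMap D A a') +
      algebraMap A F (algebraMap D A b') * algebraMap A F y) = _
    rw [← IsScalarTower.algebraMap_apply, ← IsScalarTower.algebraMap_apply]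
    simp only [map_mul]
    ring
  exact { }

end AdjoinRoot

/-! ### The curve ring, its fibres and its localization -/

theorem Polynomial.eq_zero_of_sq_sub_mul_sq_eq_zero {T : Type*} [CommRing T] [IsDomain T]
    {g : T[X]} (hg : g.Monic) (hodd : Odd g.natDegree) (a b : T[X])
    (h : a ^ 2 - g * b ^ 2 = 0) : a = 0 ∧ b = 0 := by
  have hb : b = 0 := by
    by_contra hb
    have hdeg := congrArg natDegree (sub_eq_zero.mp h)
    rw [Polynomial.natDegree_mul hg.ne_zero (pow_ne_zero 2 hb), natDegree_pow, natDegree_pow] at hdeg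
    obtain ⟨k, hk⟩ := hodd
    omega
  subst hb
  simpa using h

namespace CurveRing

variable {R : Type*} [CommRing R] (f : R[X]) {T T' : Type*} [CommRing T] [CommRing T']
  [Algebra R T] [Algebra R T']

theorem isDomain [IsDomain T] (hf : f.Monic) (hodd : Odd f.natDegree) :
    IsDomain (CurveRing f T) :=
  AdjoinRoot.isDomain_X_sq_sub_C
    (eq_zero_of_sq_sub_mul_sq_eq_zero (hf.map (algebraMap R T)) (by rwa [hf.natDegree_map]))

theorem isDedekindDomain {k : Type*} [Field k] [Algebra R k] (hf : f.Monic)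
    (hodd : Odd f.natDegree) (h2 : (2 : k) ≠ 0)
    (hsep : (f.map (algebraMap R k)).Separable) : IsDedekindDomain (CurveRing f k) := by
  refine AdjoinRoot.isDedekindDomain_X_sq_sub_C ?_ hsep.squarefree (hf.map _).ne_zero
    (isDomain f hf hodd)
  have : (2 : k[X]) = C 2 := rfl
  rw [this, isUnit_C]
  exact h2.isUnit

section map

variable (φ : T →ₐ[R] T')

theorem map_of (p : T[X]) :
    CurveRing.map f φ (AdjoinRoot.of _ p) = AdjoinRoot.of _ (p.map (φ : T →+* T')) := by
  simp [CurveRing.map, AdjoinRoot.map]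

theorem map_root : CurveRing.map f φ (AdjoinRoot.root _) = AdjoinRoot.root _ := by
  simp [CurveRing.map, AdjoinRoot.map]

theorem map_algebraMap (t : T) :
    CurveRing.map f φ (algebraMap T (CurveRing f T) t) = AdjoinRoot.of _ (C (φ t)) :=
  (map_of f φ (C t)).trans (by rw [Polynomial.map_C]; rfl)

theorem map_of_add_of_mul_root (p q : T[X]) :
    CurveRing.map f φ (AdjoinRoot.of _ p + AdjoinRoot.of _ q * AdjoinRoot.root _) =
      AdjoinRoot.of _ (p.map (φ : T →+* T')) +
        AdjoinRoot.of _ (q.map (φ : T →+* T')) * AdjoinRoot.root _ := by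
  rw [map_add, map_mul, map_of, map_of, map_root]

variable {φ}

theorem map_injective (hφ : Function.Injective φ) : Function.Injective (CurveRing.map f φ) := by
  rw [injective_iff_map_eq_zero]
  intro z hz
  obtain ⟨p, q, rfl⟩ := AdjoinRoot.exists_of_add_of_mul_root z
  rw [map_of_add_of_mul_root, AdjoinRoot.of_add_of_mul_root_eq_zero_iff,
    Polynomial.map_eq_zero_iff (f := (φ : T →+* T')) hφ,
    Polynomial.map_eq_zero_iff (f := (φ : T →+* T')) hφ] at hz
  rw [AdjoinRoot.of_add_of_mul_root_eq_zero_iff]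
  exact hz

theorem map_surjective (hφ : Function.Surjective φ) :
    Function.Surjective (CurveRing.map f φ) := by
  intro z
  obtain ⟨p, q, rfl⟩ := AdjoinRoot.exists_of_add_of_mul_root z
  obtain ⟨p, rfl⟩ := Polynomial.map_surjective (φ : T →+* T') hφ p
  obtain ⟨q, rfl⟩ := Polynomial.map_surjective (φ : T →+* T') hφ q
  exact ⟨_, map_of_add_of_mul_root f φ p q⟩

variable (φ)

/-- The kernel is read off coefficientwise in the basis 1, Y. This identifies the fibre over p with
the curve over T ⧸ p. -/
theorem ker_map : RingHom.ker (CurveRing.map f φ) =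
    (RingHom.ker (φ : T →+* T')).map (algebraMap T (CurveRing f T)) := by
  apply le_antisymm
  · intro z hz
    obtain ⟨p, q, rfl⟩ := AdjoinRoot.exists_of_add_of_mul_root z
    rw [RingHom.mem_ker, map_of_add_of_mul_root, AdjoinRoot.of_add_of_mul_root_eq_zero_iff] at hz
    have key : ∀ p : T[X], p.map (φ : T →+* T') = 0 →
        AdjoinRoot.of ((X : T[X][X]) ^ 2 - C (f.map (algebraMap R T))) p ∈
          (RingHom.ker (φ : T →+* T')).map (algebraMap T (CurveRing f T)) := by
      intro p hp
      have h1 : p ∈ (RingHom.ker (φ : T →+* T')).map (C : T →+* T[X]) := by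
        rw [Ideal.mem_map_C_iff]
        intro n
        rw [RingHom.mem_ker, ← coeff_map, hp, coeff_zero]
      have h2 := Ideal.mem_map_of_mem
        (AdjoinRoot.of ((X : T[X][X]) ^ 2 - C (f.map (algebraMap R T)))) h1
      rw [Ideal.map_map] at h2
      exact h2
    exact add_mem (key p hz.1) (Ideal.mul_mem_right _ _ (key q hz.2))
  · rw [Ideal.map_le_iff_le_comap]
    intro t ht
    have ht : φ t = 0 := ht
    rw [Ideal.mem_comap, RingHom.mem_ker, map_algebraMap, ht, map_zero, map_zero]

end map

theorem faithfulSMul : FaithfulSMul T (CurveRing f T) := by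
  rw [faithfulSMul_iff_algebraMap_injective, injective_iff_map_eq_zero]
  intro t ht
  have h : AdjoinRoot.of ((X : T[X][X]) ^ 2 - C (f.map (algebraMap R T))) (C t) +
      AdjoinRoot.of _ 0 * AdjoinRoot.root _ = 0 := by
    rw [map_zero, zero_mul, add_zero]
    exact ht
  exact C_eq_zero.mp (AdjoinRoot.of_add_of_mul_root_eq_zero_iff.mp h).1

theorem isLocalization_algebraMapSubmonoid [Algebra T T'] [IsFractionRing T T']
    (φ : T →ₐ[R] T') (hφ : ∀ t, φ t = algebraMap T T' t) :
    letI := (CurveRing.map f φ).toAlgebra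
    IsLocalization (Algebra.algebraMapSubmonoid (CurveRing f T) T⁰) (CurveRing f T') := by
  let := (CurveRing.map f φ).toAlgebra
  have hφ' : (φ : T →+* T') = algebraMap T T' := RingHom.ext hφ
  have hinj : Function.Injective φ := by
    rw [funext hφ]
    exact IsFractionRing.injective T T'
  have halg : ∀ z, algebraMap (CurveRing f T) (CurveRing f T') z = CurveRing.map f φ z :=
    fun _ => rfl
  constructor
  constructor
  · rintro ⟨_, t, ht, rfl⟩
    rw [halg, map_algebraMap, hφ]
    exact ((IsLocalization.map_units T' ⟨t, ht⟩).map C).map (AdjoinRoot.of _)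
  · intro z
    obtain ⟨p, q, rfl⟩ := AdjoinRoot.exists_of_add_of_mul_root z
    obtain ⟨d, hd, hdp⟩ := IsLocalization.integerNormalization_spec T⁰ p
    obtain ⟨e, he, heq⟩ := IsLocalization.integerNormalization_spec T⁰ q
    set p' := IsLocalization.integerNormalization T⁰ p
    set q' := IsLocalization.integerNormalization T⁰ q
    refine ⟨⟨AdjoinRoot.of _ (C e * p') + AdjoinRoot.of _ (C d * q') * AdjoinRoot.root _,
      ⟨_, d * e, mul_mem hd he, rfl⟩⟩, ?_⟩
    rw [halg, halg, map_algebraMap, map_of_add_of_mul_root, Polynomial.map_mul,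
      Polynomial.map_mul, Polynomial.map_C, Polynomial.map_C, hφ', hdp, heq, hφ,
      map_mul, map_mul]
    simp only [Algebra.smul_def, Polynomial.algebraMap_apply, map_mul]
    ring
  · intro x y hxy
    exact ⟨1, by rw [map_injective f hinj hxy]⟩

end CurveRing

/-- If the discriminant of a monic polynomial becomes a unit in a field, the polynomial becomes
separable. -/
theorem Polynomial.Monic.separable_map_of_discr {R k : Type*} [CommRing R] [Field k]
    {f : R[X]} (hf : f.Monic) (hdeg : 0 < f.natDegree) (φ : R →+* k) (h : φ f.discr ≠ 0) :
    (f.map φ).Separable := by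
  -- The Bézout identity for f and f' is formed over R and only then mapped to k, so a drop in the
  -- degree of f' in k does no harm.
  obtain ⟨p, q, -, -, hpq⟩ := exists_mul_add_mul_eq_C_resultant f (derivative f)
    (m := f.natDegree) (n := f.natDegree - 1) le_rfl (natDegree_derivative_le f)
    (Or.inl hdeg.ne')
  rw [resultant_deriv (natDegree_pos_iff_degree_pos.mp hdeg), hf.leadingCoeff, mul_one] at hpq
  have hu : φ ((-1) ^ (f.natDegree * (f.natDegree - 1) / 2) * f.discr) ≠ 0 := by
    rw [map_mul, map_pow, map_neg, map_one]
    exact mul_ne_zero (pow_ne_zero _ (neg_ne_zero.mpr one_ne_zero)) h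
  have hpq' := congrArg (Polynomial.map φ) hpq
  rw [Polynomial.map_add, Polynomial.map_mul, Polynomial.map_mul, Polynomial.map_C,
    ← derivative_map] at hpq'
  refine ⟨C (φ ((-1) ^ (f.natDegree * (f.natDegree - 1) / 2) * f.discr))⁻¹ * p.map φ,
    C (φ ((-1) ^ (f.natDegree * (f.natDegree - 1) / 2) * f.discr))⁻¹ * q.map φ, ?_⟩
  have : C (φ ((-1) ^ (f.natDegree * (f.natDegree - 1) / 2) * f.discr))⁻¹ *
      C (φ ((-1) ^ (f.natDegree * (f.natDegree - 1) / 2) * f.discr)) = (1 : k[X]) := by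
    rw [← C_mul, inv_mul_cancel₀ hu, C_1]
  rw [← this, ← hpq']
  ring

/-! ### S-integers as a localization -/

section SIntegers

open IsDedekindDomain

variable {R : Type*} [CommRing R] [IsDedekindDomain R] [Finite (ClassGroup R)]

theorem Ideal.exists_pow_eq_span_of_finite_classGroup {I : Ideal R} (hI : I ≠ ⊥) :
    ∃ n ≠ 0, ∃ x : R, I ^ n = Ideal.span {x} := by
  refine ⟨Nat.card (ClassGroup R), Nat.card_pos.ne', ?_⟩
  let I' : (Ideal R)⁰ := ⟨I, mem_nonZeroDivisors_of_ne_zero hI⟩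
  have h1 : ClassGroup.mk0 I' ^ Nat.card (ClassGroup R) = 1 := pow_card_eq_one'
  have h2 : ClassGroup.mk0 (I' ^ Nat.card (ClassGroup R)) = 1 := by rw [map_pow, h1]
  have h3 := (ClassGroup.mk0_eq_one_iff (I' ^ Nat.card (ClassGroup R)).2).mp h2
  rw [SubmonoidClass.coe_pow] at h3
  exact h3.principal

variable (S : Set (HeightOneSpectrum R))

omit [Finite (ClassGroup R)] in
/-- The nonzero elements of `R` that lie in no prime outside of `S`. -/
def primeToCompl : Submonoid R where
  carrier := {x | x ≠ 0 ∧ ∀ v : HeightOneSpectrum R, v ∉ S → x ∉ v.asIdeal}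
  one_mem' := ⟨one_ne_zero, fun v _ => (Ideal.ne_top_iff_one _).mp v.isPrime.ne_top⟩
  mul_mem' := fun ⟨hx0, hx⟩ ⟨hy0, hy⟩ =>
    ⟨mul_ne_zero hx0 hy0, fun v hv => v.isPrime.mul_notMem (hx v hv) (hy v hv)⟩

variable (K : Type*) [Field K] [Algebra R K] [IsFractionRing R K]

instance Set.integer.isLocalization : IsLocalization (primeToCompl S) (S.integer K) := by
  have hinj : Function.Injective (algebraMap R (S.integer K)) := by
    have h := IsFractionRing.injective R K
    rw [IsScalarTower.algebraMap_eq R (S.integer K) K, RingHom.coe_comp] at h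
    exact Function.Injective.of_comp h
  constructor
  constructor
  · rintro ⟨x, hx0, hx⟩
    have hxK : algebraMap R K x ≠ 0 := by simpa using hx0
    refine IsUnit.of_mul_eq_one ⟨(algebraMap R K x)⁻¹, fun v hv => ?_⟩
      (Subtype.ext (mul_inv_cancel₀ hxK))
    rw [map_inv₀, (HeightOneSpectrum.valuation_eq_one_iff_notMem v).mpr (hx v hv), inv_one]
  · intro y
    -- J is the ideal of denominators of y; a generator x of a principal power of J is a denominator
    -- lying in no prime outside S.
    let J : Ideal R := (1 : Submodule R K).comap (LinearMap.toSpanSingleton R K (y : K))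
    have hJ : ∀ d, d ∈ J ↔ ∃ z, algebraMap R K z = algebraMap R K d * y := fun d => by
      simp [J, Submodule.mem_one, Algebra.smul_def]
    have hJ0 : J ≠ ⊥ := by
      obtain ⟨⟨a, b⟩, hab⟩ := IsLocalization.surj R⁰ (y : K)
      intro h
      have hb : (b : R) ∈ J := (hJ _).mpr ⟨a, by rw [← hab, mul_comm]⟩
      rw [h] at hb
      exact nonZeroDivisors.coe_ne_zero b hb
    obtain ⟨n, hn, x, hx⟩ := Ideal.exists_pow_eq_span_of_finite_classGroup hJ0
    have hxmem : x ∈ J ^ n := hx ▸ Ideal.mem_span_singleton_self x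
    obtain ⟨z, hz⟩ := (hJ x).mp (Ideal.pow_le_self hn hxmem)
    refine ⟨⟨z, x, ?_, fun v hv hxv => ?_⟩, Subtype.ext (by rw [mul_comm]; exact hz.symm)⟩
    · rintro rfl
      rw [Ideal.span_singleton_eq_bot.mpr rfl] at hx
      exact hJ0 (pow_eq_zero_iff hn |>.mp hx)
    · obtain ⟨c, d, hcd⟩ := v.exists_primeCompl_mul_eq_of_integer (y : K) (y.2 v hv)
      have hd : (d : R) ∈ J := (hJ _).mpr ⟨c, by rw [← hcd, mul_comm]⟩
      refine d.2 (v.isPrime.mem_of_pow_mem n ?_)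
      have hdn : (d : R) ^ n ∈ J ^ n := Ideal.pow_mem_pow hd n
      rw [hx] at hdn
      exact (Ideal.span_singleton_le_iff_mem _).mpr hxv hdn
  · intro x y h
    exact ⟨1, by rw [hinj h]⟩

omit [Finite (ClassGroup R)] in
theorem primeToCompl_le_nonZeroDivisors : primeToCompl S ≤ R⁰ := fun _ hx =>
  mem_nonZeroDivisors_of_ne_zero hx.1

instance Set.integer.isDedekindDomain : IsDedekindDomain (S.integer K) :=
  IsLocalization.isDedekindDomain R (primeToCompl_le_nonZeroDivisors S) _

instance Set.integer.isFractionRing : IsFractionRing (S.integer K) K :=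
  IsFractionRing.isFractionRing_of_isDomain_of_isLocalization (primeToCompl S) _ _

/-- If the contraction v were in S, a principal power (w) of v would give an element w in no other
prime, hence a unit among the S-integers, yet w lies in p. -/
theorem Set.integer.exists_asIdeal_eq_comap (p : Ideal (S.integer K)) [hp : p.IsPrime]
    (hp0 : p ≠ ⊥) :
    ∃ v : HeightOneSpectrum R, v ∉ S ∧ v.asIdeal = p.comap (algebraMap R (S.integer K)) := by
  have hne : p.comap (algebraMap R (S.integer K)) ≠ ⊥ := by
    intro h
    have hmap := IsLocalization.map_under (primeToCompl S) (S.integer K) p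
    rw [Ideal.under, h, Ideal.map_bot] at hmap
    exact hp0 hmap.symm
  refine ⟨⟨p.comap (algebraMap R (S.integer K)), Ideal.comap_isPrime _ _, hne⟩,
    fun hS => ?_, rfl⟩
  set v : HeightOneSpectrum R :=
    ⟨p.comap (algebraMap R (S.integer K)), Ideal.comap_isPrime _ _, hne⟩
  obtain ⟨n, hn, w, hw⟩ := Ideal.exists_pow_eq_span_of_finite_classGroup v.ne_bot
  have hwv : w ∈ v.asIdeal :=
    Ideal.pow_le_self hn (hw ▸ Ideal.mem_span_singleton_self w)
  have hwM : w ∈ primeToCompl S := by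
    refine ⟨?_, fun v' hv' hwv' => hv' ?_⟩
    · rintro rfl
      rw [Ideal.span_singleton_eq_bot.mpr rfl] at hw
      exact v.ne_bot (pow_eq_zero_iff hn |>.mp hw)
    · have hle : v.asIdeal ≤ v'.asIdeal := by
        refine v'.isPrime.le_of_pow_le (n := n) ?_
        rw [hw]
        exact (Ideal.span_singleton_le_iff_mem _).mpr hwv'
      have := HeightOneSpectrum.ext (v.isMaximal.eq_of_le v'.isPrime.ne_top hle)
      rwa [← this]
  exact hp.ne_top (Ideal.eq_top_of_isUnit_mem p hwv
    (IsLocalization.map_units (S.integer K) (⟨w, hwM⟩ : primeToCompl S)))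

end SIntegers

/-! ### Reduction modulo primes and the main theorem -/

theorem genericFibreHom_injective {K : Type*} [Field K] [NumberField K] (f : (𝓞 K)[X])
    (S : Set (IsDedekindDomain.HeightOneSpectrum (𝓞 K))) :
    Function.Injective (genericFibreHom f S) :=
  CurveRing.map_injective f Subtype.val_injective

theorem CurveRing.exists_fibre {K : Type u} [Field K] [NumberField K] (f : (𝓞 K)[X])
    (hf : f.Monic) (hodd : Odd f.natDegree)
    (S : Set (IsDedekindDomain.HeightOneSpectrum (𝓞 K)))
    (hS : ∀ v : IsDedekindDomain.HeightOneSpectrum (𝓞 K),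
      v.asIdeal ∣ Ideal.span {2 * f.discr} → v ∈ S)
    (p : Ideal (S.integer K)) (hp : p.IsPrime) (hp0 : p ≠ ⊥) :
    ∃ (D : Type u) (_ : CommRing D) (_ : IsDedekindDomain D)
      (π : CurveRing f (S.integer K) →+* D), Function.Surjective π ∧
        RingHom.ker π = p.map (algebraMap (S.integer K) (CurveRing f (S.integer K))) := by
  have := hp.isMaximal hp0
  let _ : Field (S.integer K ⧸ p) := Ideal.Quotient.field p
  let φ := Ideal.Quotient.mkₐ (𝓞 K) p
  obtain ⟨v, hvS, hv⟩ := Set.integer.exists_asIdeal_eq_comap S K p hp0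
  have hdisc : algebraMap (𝓞 K) (S.integer K ⧸ p) (2 * f.discr) ≠ 0 := by
    intro h
    refine hvS (hS v (Ideal.dvd_span_singleton.mpr ?_))
    rw [hv]
    exact (Ideal.Quotient.eq_zero_iff_mem (I := p)).mp h
  rw [map_mul, map_ofNat] at hdisc
  have hdeg : 0 < f.natDegree := hodd.pos
  refine ⟨CurveRing f (S.integer K ⧸ p), inferInstance,
    CurveRing.isDedekindDomain f hf hodd (left_ne_zero_of_mul hdisc)
      (hf.separable_map_of_discr hdeg _ (right_ne_zero_of_mul hdisc)), CurveRing.map f φ,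
    CurveRing.map_surjective f Ideal.Quotient.mk_surjective, ?_⟩
  rw [CurveRing.ker_map]
  congr 1
  exact Ideal.mk_ker

/-- The quotient by p embeds in the curve ring over T/(p), which is a domain. -/
theorem CurveRing.prime_algebraMap {R T : Type*} [CommRing R] [CommRing T] [IsDomain T]
    [IsPrincipalIdealRing T] [Algebra R T] (f : R[X]) (hf : f.Monic) (hodd : Odd f.natDegree)
    {p : T} (hp : Prime p) : Prime (algebraMap T (CurveRing f T) p) := by
  have := faithfulSMul f (T := T)
  have hp' : (Ideal.span {p}).IsPrime := (Ideal.span_singleton_prime hp.ne_zero).mpr hp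
  have := CurveRing.isDomain f (T := T ⧸ Ideal.span {p}) hf hodd
  rw [← Ideal.span_singleton_prime (by simpa using hp.ne_zero)]
  have h := RingHom.ker_isPrime (CurveRing.map f (Ideal.Quotient.mkₐ R (Ideal.span {p})))
  have hker : RingHom.ker (Ideal.Quotient.mkₐ R (Ideal.span {p}) : T →+* T ⧸ Ideal.span {p}) =
    Ideal.span {p} := Ideal.mk_ker
  rwa [CurveRing.ker_map, hker, Ideal.map_span, Set.image_singleton] at h

theorem mainTheorem7 {K : Type u} [Field K] [NumberField K] (f : (𝓞 K)[X])
    (hf_sqf : Squarefree f) (hf_monic : f.Monic) (hf_odd : Odd f.natDegree)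
    (hf_deg : 3 ≤ f.natDegree)
    (S : Set (IsDedekindDomain.HeightOneSpectrum (𝓞 K))) (hS : S.Finite) :
    letI : Algebra (CurveRing f (S.integer K)) (CurveRing f K) := (genericFibreHom f S).toAlgebra
    ∃ θ : CommRing.Pic (CurveRing f (S.integer K)) →* CommRing.Pic (CurveRing f K),
      (∀ (M : Type u) [AddCommGroup M] [Module (CurveRing f (S.integer K)) M]
          [Module.Invertible (CurveRing f (S.integer K)) M],
        θ (CommRing.Pic.mk (CurveRing f (S.integer K)) M) =
          CommRing.Pic.mk (CurveRing f K)
            (CurveRing f K ⊗[CurveRing f (S.integer K)] M)) ∧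
      ((∀ v : IsDedekindDomain.HeightOneSpectrum (𝓞 K),
          v.asIdeal ∣ Ideal.span {2 * f.discr} → v ∈ S) → Function.Surjective θ) ∧
      (IsPrincipalIdealRing (S.integer K) → Function.Injective θ) := by
  let : Algebra (CurveRing f (S.integer K)) (CurveRing f K) := (genericFibreHom f S).toAlgebra
  have := CurveRing.isDomain f (T := S.integer K) hf_monic hf_odd
  have := CurveRing.isDomain f (T := K) hf_monic hf_odd
  have := CurveRing.faithfulSMul f (T := S.integer K)
  have : FaithfulSMul (CurveRing f (S.integer K)) (CurveRing f K) :=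
    (faithfulSMul_iff_algebraMap_injective _ _).mpr (genericFibreHom_injective f S)
  have : IsLocalization
      (Algebra.algebraMapSubmonoid (CurveRing f (S.integer K)) (S.integer K)⁰)
      (CurveRing f K) :=
    CurveRing.isLocalization_algebraMapSubmonoid f (S.integer K).val fun _ => rfl
  refine ⟨CommRing.Pic.mapAlgebra _ _, fun M _ _ _ => CommRing.Pic.mapAlgebra_mk M,
    fun hdisc => ?_, fun hpid => ?_⟩
  · exact CommRing.Pic.mapAlgebra_surjective (R := S.integer K)
      (CurveRing.exists_fibre f hf_monic hf_odd S hdisc)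
  · exact CommRing.Pic.mapAlgebra_injective (R := S.integer K)
      fun p hp => CurveRing.prime_algebraMap f hf_monic hf_odd hp
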